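/- Let $M \ge 1$ be an integer and, for each $i \in \{1,\dots,M\}$, let $\bar f_i, \bar v_i, r_i^{\min}, r_i^{\max}$ be real numbers with $\bar f_i \ge \bar v_i > 0$ and $0 < r_i^{\min} \le r_i^{\max}$. Consider the $M$-player game in which player (builder) $i$ chooses $h_i$ in the strategy space $B_i = [r_i^{\min}, r_i^{\max}]$ and receives, at the strategy profile $h = (h_1,\dots,h_M)$, the payoff $$\pi_i(h) = \bar f_i\, \frac{h_i}{\sum_{j=1}^M h_j} + \bar v_i \left(\frac{h_i}{\sum_{j=1}^M h_j}\right)^2 - \frac{h_i^2}{\sum_{j=1}^M h_j}.$$ Then this game has a pure-strategy Nash equilibrium: there exists $h^* \in B_1 \times \cdots \times B_M$ such that, for every $i$ and every $h_i \in B_i$, $\pi_i(h_i^*, h_{-i}^*) \ge \pi_i(h_i, h_{-i}^*)$, where $(h_i, h_{-i}^*)$ denotes $h^*$ with its $i$-th coordinate replaced by $h_i$. -/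

import Mathlib

/-- A game in strategic (normal) form in which the pure strategies of every player are
real numbers: each player has a set of admissible strategies and a payoff that depends on
the whole strategy profile. -/
structure StrategicGame (ι : Type*) where
  /-- the set of admissible pure strategies of a player -/
  strategies : ι → Set ℝ
  /-- the payoff of a player at a strategy profile -/
  payoff : ι → (ι → ℝ) → ℝ

/-- A pure-strategy Nash equilibrium: an admissible profile from which no player can
strictly gain by deviating alone to another admissible strategy. -/
def StrategicGame.IsPureNashEquilibrium {ι : Type*} [DecidableEq ι]
    (G : StrategicGame ι) (h : ι → ℝ) : Prop :=
  (∀ i, h i ∈ G.strategies i) ∧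
    ∀ i, ∀ x ∈ G.strategies i, G.payoff i (Function.update h i x) ≤ G.payoff i h

/-- The share `h i / ∑ j, h j`: the probability that builder `i` wins an auction when the
expected bids are `h`. -/
noncomputable def winShare {M : ℕ} (h : Fin M → ℝ) (i : Fin M) : ℝ :=
  h i / ∑ j, h j

/-- The game of `M` builders: builder `i` chooses an expected bid in `[rmin i, rmax i]`, and
receives the expected utility `f i * p + v i * p ^ 2 - (h i) ^ 2 / ∑ j, h j`, where `p` is the
share `h i / ∑ j, h j`. -/
noncomputable def builderGame {M : ℕ} (f v rmin rmax : Fin M → ℝ) : StrategicGame (Fin M) where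
  strategies i := Set.Icc (rmin i) (rmax i)
  payoff i h := f i * winShare h i + v i * winShare h i ^ 2 - h i ^ 2 / ∑ j, h j

/-! A payoff depends only on a builder's own bid and the total, so the game is aggregative. For a
prescribed total `s`, the first-order condition clamped to the strategy interval gives one bid,
`replacementBid`, continuous in `s`. By the intermediate value theorem some `s` equals the sum of
these bids (`exists_sum_replacementBid_eq`). Payoffs need not be concave, but
`payoff_le_of_marginal` shows that the first-order condition still yields a global best reply. -/

/-- The larger root `d` of `t ^ 2 + (2 * v - f - 2 * s) * t + (s - 2 * v) * f`. A builder whose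
marginal payoff vanishes when the total bid is `s` has the share `f / d`. -/
noncomputable def upperRoot (f v s : ℝ) : ℝ :=
  (2 * s + f - 2 * v + √((2 * v + f - 2 * s) ^ 2 + 4 * f * s)) / 2

/-- The bid in `[a, b]` that satisfies a builder's first-order condition at the total bid `s`. -/
noncomputable def replacementBid (f v a b s : ℝ) : ℝ :=
  max a (min b (s * f / upperRoot f v s))

theorem upperRoot_eq_zero {f v s : ℝ} (hf : 0 < f) (hs : 0 < s) :
    upperRoot f v s ^ 2 + (2 * v - f - 2 * s) * upperRoot f v s + (s - 2 * v) * f = 0 := by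
  have h := Real.sq_sqrt (show 0 ≤ (2 * v + f - 2 * s) ^ 2 + 4 * f * s by positivity)
  unfold upperRoot
  linear_combination h / 4

/-- The quadratic takes the value `-s * f < 0` at `f`, so `f` lies strictly between its roots. -/
theorem lt_upperRoot {f v s : ℝ} (hf : 0 < f) (hs : 0 < s) : f < upperRoot f v s := by
  have h : 2 * v + f - 2 * s < √((2 * v + f - 2 * s) ^ 2 + 4 * f * s) :=
    Real.lt_sqrt_of_sq_lt (by linarith [mul_pos hf hs])
  unfold upperRoot
  linarith

/-- If `s > 2 * v`, the quadratic is `-s * (s - 2 * v) < 0` at `s - 2 * v`. This bound fixes the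
sign of the second factor of the marginal payoff. -/
theorem sub_lt_upperRoot {f v s : ℝ} (hf : 0 < f) (hs : 0 < s) :
    s - 2 * v < upperRoot f v s := by
  rcases le_or_gt (s - 2 * v) 0 with h | h
  · linarith [lt_upperRoot (v := v) hf hs]
  · have h : -f - 2 * v < √((2 * v + f - 2 * s) ^ 2 + 4 * f * s) :=
      Real.lt_sqrt_of_sq_lt (by nlinarith [mul_pos h hs])
    unfold upperRoot
    linarith

theorem continuousOn_replacementBid {f v a b : ℝ} (hf : 0 < f) :
    ContinuousOn (replacementBid f v a b) (Set.Ioi 0) := by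
  have hd : Continuous (upperRoot f v) := by unfold upperRoot; fun_prop
  refine ContinuousOn.sup continuousOn_const (ContinuousOn.inf continuousOn_const ?_)
  exact ContinuousOn.div (by fun_prop) hd.continuousOn
    fun s hs => (hf.trans (lt_upperRoot hf hs)).ne'

theorem replacementBid_mem_Icc {f v a b s : ℝ} (hab : a ≤ b) :
    replacementBid f v a b s ∈ Set.Icc a b :=
  ⟨le_max_left _ _, max_le hab (min_le_left _ _)⟩

/-- The scaled marginal payoff at the bid `x = replacementBid f v a b s` and the total bid `s`
points out of `[a, b]` or vanishes. -/
theorem marginal_mul_sub_nonpos {f v a b s x y : ℝ} (hf : 0 < f) (hs : 0 < s) (hx : 0 < x)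
    (hxs : x ≤ s) (hxr : x = replacementBid f v a b s) (hy : y ∈ Set.Icc a b) :
    ((s - x) * (f * s + 2 * v * x) - (2 * s * x - x ^ 2) * s) * (y - x) ≤ 0 := by
  have hroot := upperRoot_eq_zero (v := v) hf hs
  have hd := hf.trans (lt_upperRoot (v := v) hf hs)
  have had := sub_lt_upperRoot (v := v) hf hs
  -- The marginal is quadratic in `x`, with `s * f / d` as a root; the other factor is nonpositive
  -- for `0 < x ≤ s`.
  have hfactor : (s - x) * (f * s + 2 * v * x) - (2 * s * x - x ^ 2) * s =
      (x - s * f / upperRoot f v s) * ((s - 2 * v) * x - upperRoot f v s * s) := by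
    field_simp
    linear_combination (s * x) * hroot
  have hneg : (s - 2 * v) * x - upperRoot f v s * s ≤ 0 := by
    nlinarith [mul_le_mul_of_nonneg_right had.le hx.le, mul_le_mul_of_nonneg_left hxs hd.le]
  have hsign : 0 ≤ (x - s * f / upperRoot f v s) * (y - x) := by
    rw [replacementBid] at hxr
    rcases lt_trichotomy y x with h | rfl | h
    · have : x ≤ s * f / upperRoot f v s := by
        rcases max_choice a (min b (s * f / upperRoot f v s)) with hm | hm
        · linarith [hy.1]
        · rw [hxr, hm]; exact min_le_right _ _
      nlinarith
    · simp
    · have : s * f / upperRoot f v s ≤ x := by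
        rcases min_choice b (s * f / upperRoot f v s) with hm | hm
        · linarith [hy.2, le_max_right a (min b (s * f / upperRoot f v s))]
        · rw [hxr]; exact hm.symm.le.trans (le_max_right _ _)
      nlinarith
  rw [hfactor]
  nlinarith [mul_nonneg hsign (neg_nonneg.mpr hneg)]

/-- The first-order condition suffices for a global best reply `x` to the total bid `t` of the
other builders. -/
theorem payoff_le_of_marginal {f v t x y : ℝ} (hv : 0 < v) (hfv : v ≤ f) (ht : 0 ≤ t)
    (hx : 0 < x) (hy : 0 < y)
    (h : (t * (f * (x + t) + 2 * v * x) - (x ^ 2 + 2 * t * x) * (x + t)) * (y - x) ≤ 0) :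
    f * (y / (y + t)) + v * (y / (y + t)) ^ 2 - y ^ 2 / (y + t) ≤
      f * (x / (x + t)) + v * (x / (x + t)) ^ 2 - x ^ 2 / (x + t) := by
  have hxt : 0 < x + t := by linarith
  have hyt : 0 < y + t := by linarith
  -- the difference quotient of the payoff, cleared of denominators
  let B := t * (f * (x + t) * (y + t) + v * (x * (y + t) + y * (x + t)))
    - (x * y + t * (x + y)) * (x + t) * (y + t)
  have hdiff : f * (y / (y + t)) + v * (y / (y + t)) ^ 2 - y ^ 2 / (y + t) -
      (f * (x / (x + t)) + v * (x / (x + t)) ^ 2 - x ^ 2 / (x + t)) =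
      (y - x) * B / ((x + t) ^ 2 * (y + t) ^ 2) := by
    simp only [B]
    field_simp
    ring
  -- Up to positive factors, the payoff gain is the first-order term minus a multiple of `(y - x) ^
  -- 2`, nonnegative under `h0`.
  have concave (h0 : 0 ≤ (x + t) * (f - x) + v * x) : (y - x) * B ≤ 0 := by
    have hquad : x * ((y - x) * B) = y * (x + t) *
        ((t * (f * (x + t) + 2 * v * x) - (x ^ 2 + 2 * t * x) * (x + t)) * (y - x)) -
        (t ^ 2 * ((x + t) * (f - x) + v * x) + (x + t) ^ 2 * (x * y)) * (y - x) ^ 2 := by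
      simp only [B]
      ring
    have h1 := mul_nonpos_of_nonneg_of_nonpos (show 0 ≤ y * (x + t) by positivity) h
    have h2 : 0 ≤ (t ^ 2 * ((x + t) * (f - x) + v * x) + (x + t) ^ 2 * (x * y)) *
        (y - x) ^ 2 := by positivity
    exact nonpos_of_mul_nonpos_right (by linarith) hx
  have hB : (y - x) * B ≤ 0 := by
    rcases le_or_gt x y with hxy | hxy
    · by_cases h0 : 0 ≤ (x + t) * (f - x) + v * x
      · exact concave h0
      · have hvx : v < x := by nlinarith [mul_pos hv hx]
        have h1 : t * (y + t) * (f * (x + t) + v * x) ≤ t * (y + t) * (x * (x + t)) :=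
          mul_le_mul_of_nonneg_left (by linarith) (by positivity)
        have h2 : t * y * (x + t) * v ≤ t * y * (x + t) * x :=
          mul_le_mul_of_nonneg_left hvx.le (by positivity)
        have h3 : 0 ≤ (x * y + t * y) * (x + t) * (y + t) - t * y * (x + t) * x := by
          have : 0 ≤ y * (x + t) * ((x + t) * y + t * t) := by positivity
          linarith
        refine mul_nonpos_of_nonneg_of_nonpos (sub_nonneg.mpr hxy) ?_
        simp only [B]
        linarith
    -- For `y < x`, failure of `h0` would make the marginal at `x` negative, against `h`.
    · refine concave (le_of_not_gt fun h0 => ?_)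
      have hvx : v < x := by nlinarith [mul_pos hv hx]
      have h1 : t * (f * (x + t) + v * x) ≤ t * (x * (x + t)) :=
        mul_le_mul_of_nonneg_left (by linarith) ht
      have h2 : t * x * v ≤ t * x * x :=
        mul_le_mul_of_nonneg_left hvx.le (by positivity)
      have h3 : 0 < x ^ 2 * (x + t) + t * x * t := by positivity
      have hneg : t * (f * (x + t) + 2 * v * x) - (x ^ 2 + 2 * t * x) * (x + t) < 0 := by
        linarith
      exact absurd (mul_pos_of_neg_of_neg hneg (sub_neg.mpr hxy)) (not_lt.mpr h)
  have := div_nonpos_of_nonpos_of_nonneg hB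
    (show 0 ≤ (x + t) ^ 2 * (y + t) ^ 2 by positivity)
  linarith

theorem exists_sum_replacementBid_eq {ι : Type*} [Fintype ι] [Nonempty ι] (f v a b : ι → ℝ)
    (hf : ∀ i, 0 < f i) (ha : ∀ i, 0 < a i) (hab : ∀ i, a i ≤ b i) :
    ∃ s, 0 < s ∧ ∑ i, replacementBid (f i) (v i) (a i) (b i) s = s := by
  have hpos : 0 < ∑ i, a i := Finset.sum_pos (fun i _ => ha i) Finset.univ_nonempty
  have hle : ∑ i, a i ≤ ∑ i, b i := Finset.sum_le_sum fun i _ => hab i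
  have hcont : ContinuousOn
      (fun s => ∑ i, replacementBid (f i) (v i) (a i) (b i) s - s)
      (Set.Icc (∑ i, a i) (∑ i, b i)) := by
    refine ContinuousOn.sub (continuousOn_finsetSum _ fun i _ => ?_) continuousOn_id
    exact (continuousOn_replacementBid (hf i)).mono fun s hs => hpos.trans_le hs.1
  -- Clamping makes the difference nonnegative at `∑ i, a i` and nonpositive at `∑ i, b i`.
  obtain ⟨s, hs, hs0⟩ := intermediate_value_Icc' hle hcont
    (show (0 : ℝ) ∈ Set.Icc _ _ from
      ⟨sub_nonpos.mpr (Finset.sum_le_sum fun i _ => (replacementBid_mem_Icc (hab i)).2),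
        sub_nonneg.mpr (Finset.sum_le_sum fun i _ => (replacementBid_mem_Icc (hab i)).1)⟩)
  exact ⟨s, hpos.trans_le hs.1, sub_eq_zero.mp hs0⟩

theorem mainTheorem1 (M : ℕ) (hM : 0 < M) (f v rmin rmax : Fin M → ℝ)
    (hv : ∀ i, 0 < v i) (hfv : ∀ i, v i ≤ f i)
    (hrmin : ∀ i, 0 < rmin i) (hr : ∀ i, rmin i ≤ rmax i) :
    ∃ h : Fin M → ℝ, (builderGame f v rmin rmax).IsPureNashEquilibrium h := by
  have : Nonempty (Fin M) := ⟨⟨0, hM⟩⟩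
  have hf : ∀ i, 0 < f i := fun i => (hv i).trans_le (hfv i)
  obtain ⟨s, hs, hsum⟩ := exists_sum_replacementBid_eq f v rmin rmax hf hrmin hr
  set h : Fin M → ℝ := fun i => replacementBid (f i) (v i) (rmin i) (rmax i) s with hdef
  have hmem : ∀ i, h i ∈ Set.Icc (rmin i) (rmax i) := fun i => replacementBid_mem_Icc (hr i)
  have hpos : ∀ i, 0 < h i := fun i => (hrmin i).trans_le (hmem i).1
  have hsum : ∑ j, h j = s := hsum
  refine ⟨h, hmem, fun i y hy => ?_⟩
  have hle : h i ≤ s :=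
    hsum ▸ Finset.single_le_sum (fun j _ => (hpos j).le) (Finset.mem_univ i)
  have hupd : ∑ j, Function.update h i y j = y + (s - h i) := by
    rw [Finset.sum_update_of_mem (Finset.mem_univ i), ← hsum,
      ← Finset.add_sum_erase _ _ (Finset.mem_univ i), Finset.sdiff_singleton_eq_erase]
    ring
  have hreply := payoff_le_of_marginal (t := s - h i) (y := y) (hv i) (hfv i)
    (sub_nonneg.mpr hle) (hpos i) ((hrmin i).trans_le hy.1) (by
      convert marginal_mul_sub_nonpos (hf i) hs (hpos i) hle rfl hy using 1
      ring)
  rw [add_sub_cancel] at hreply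
  simpa only [builderGame, winShare, Function.update_self, hupd, hsum] using hreply
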